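/- For integers $k,n\ge 1$ with $n>k$, the Kneser graph $K(k,n)$ has the $k$-element subsets of $\{1,\dots,n\}$ as vertices, two of them being adjacent if and only if they are disjoint. In the localization game on a finite connected graph $G$ with $m\ge 1$ cops, an invisible robber first chooses a vertex. In each round the cops choose vertices $u_1,\dots,u_m$ (depending only on what they have learned so far) and learn the distances from $u_1,\dots,u_m$ to the robber's current vertex; then the robber stays where he is or moves to a neighbouring vertex. The cops win if they have a strategy which, whatever the robber does, determines the vertex that he occupies after finitely many rounds, using the distance vectors of the present and of all earlier rounds. The localization number $\zeta(G)$ is the least $m\ge 1$ for which $m$ cops win. Lemma 2.5. If $k\ge 3$ and $n\ge 3k$, then $$\zeta(K(k,n))\ \ge\ \frac n2+\frac nk-\frac k2-1 .$$ If $k=4$ (and $n\ge 3k=12$), then $$\zeta(K(4,n))\ \ge\ \frac{3n-13}{4}.$$ -/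

import Mathlib

/-- The Kneser graph `K(k,n)`: the vertices are the `k`-element subsets of an `n`-element set, and
two distinct vertices are adjacent when they are disjoint (for `k ≥ 1` disjoint vertices are
automatically distinct). -/
def kneserGraph (k n : ℕ) : SimpleGraph {s : Finset (Fin n) // s.card = k} where
  Adj s t := s ≠ t ∧ Disjoint s.1 t.1
  symm := ⟨fun _ _ h => ⟨h.1.symm, h.2.symm⟩⟩
  loopless := ⟨fun _ h => h.1 rfl⟩

namespace LocalizationGame

/-- A (deterministic) strategy for `m` cops: it places the cops on vertices, given the list of the
distance vectors that the probes of all earlier rounds returned (the most recent one first). -/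
abbrev CopStrategy (V : Type*) (m : ℕ) : Type _ := List (Fin m → ℕ) → Fin m → V

variable {V : Type*} (G : SimpleGraph V)

/-- A possible course of the robber: `ρ t` is his vertex when the cops probe in round `t`, and
between two rounds he stays where he is or moves to a neighbour. -/
def IsRobberWalk (ρ : ℕ → V) : Prop :=
  ∀ t, ρ (t + 1) = ρ t ∨ G.Adj (ρ t) (ρ (t + 1))

/-- The distance vectors of the rounds `0, …, t - 1` (the most recent one first) when the cops
play `σ` and the robber follows `ρ`. -/
noncomputable def answers {m : ℕ} (σ : CopStrategy V m) (ρ : ℕ → V) : ℕ → List (Fin m → ℕ)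
  | 0 => []
  | t + 1 => (fun i => G.dist (σ (answers σ ρ t) i) (ρ t)) :: answers σ ρ t

/-- The cops capture the robber in round `t`: the distance vectors of the rounds `0, …, t`
determine his vertex, that is, every possible course of the robber which gives the same vectors
has him at the same vertex in round `t`. -/
def CapturedAt {m : ℕ} (σ : CopStrategy V m) (ρ : ℕ → V) (t : ℕ) : Prop :=
  ∀ ρ' : ℕ → V, IsRobberWalk G ρ' →
    answers G σ ρ' (t + 1) = answers G σ ρ (t + 1) → ρ' t = ρ t

/-- `m` cops have a strategy that captures the robber after finitely many rounds, whatever he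
does. -/
def CopsWin (m : ℕ) : Prop :=
  ∃ σ : CopStrategy V m, ∀ ρ : ℕ → V, IsRobberWalk G ρ → ∃ t, CapturedAt G σ ρ t

end LocalizationGame

/-- The localization number `ζ(G)` of a finite connected graph: the least positive number of cops
that have a winning strategy in the localization game on `G`. -/
noncomputable def localizationNumber {V : Type*} (G : SimpleGraph V) : ℕ :=
  sInf {m : ℕ | 0 < m ∧ LocalizationGame.CopsWin G m}

/-! ### The game: a sufficient condition for evasion. -/

section Game

open LocalizationGame

variable {V : Type*} {G : SimpleGraph V}

/-! If the cops win, then some vertex `A` and some probe give all neighbours of `A` different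
distance vectors (`not_copsWin`); this one probe already forces the bound.

For `n ≥ 3k`, distinct vertices are at distance 1 or 2 according to disjointness, so only the traces
of the cops outside `A` matter. Let `x`, `y` lie outside `A`, neither being a singleton trace. If
fewer than `k` traces separate them, some `(k-1)`-set `D` outside `A` meets every separating trace
away from `x` and `y` (`Finset.exists_transversal_ne`), and `D ∪ {x}`, `D ∪ {y}` are neighbours of
`A` that look alike. So at least `k` traces separate each such pair.

It remains to bound such a family of traces from below (`card_mul_le_of_separating`). Since
separation is `d(x) + d(y)` minus twice the codegree, a point of low degree forces high degree on
the points sharing a trace with it. Discharging turns this into average degree `(k+2)/2`, a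
singleton trace paying for its point with weight `k`. As `n - k` points lie outside `A`, at least
`(k+2)(n-k)/(2k)` cops are needed. -/

theorem LocalizationGame.answers_congr {m : ℕ} (σ : CopStrategy V m) {ρ ρ' : ℕ → V} {t : ℕ}
    (h : ∀ s < t, ρ s = ρ' s) : answers G σ ρ t = answers G σ ρ' t := by
  induction t with
  | zero => rfl
  | succ t ih =>
    have h1 := ih fun s hs => h s (by omega)
    simp only [answers, h1, h t (by omega)]

/-- If from every vertex the robber has two possible moves which the next probe does not tell
apart, then the cops cannot win. -/
theorem LocalizationGame.not_copsWin [Nonempty V] {m : ℕ}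
    (h : ∀ (v : V) (u : Fin m → V), ∃ a b, a ≠ b ∧ G.Adj v a ∧ G.Adj v b ∧
      ∀ i, G.dist (u i) a = G.dist (u i) b) : ¬ CopsWin G m := by
  rintro ⟨σ, hσ⟩
  choose f g hne hf hg hfg using h
  obtain ⟨v₀⟩ := ‹Nonempty V›
  -- The state is the robber's vertex with the answers so far. The strategy being deterministic, the
  -- robber foresees the next probe and moves to `f`, whose twin `g` gives the same answer.
  let st : ℕ → V × List (Fin m → ℕ) := fun t => Nat.rec (v₀, [])
    (fun _ s => (f s.1 (σ s.2), (fun i => G.dist (σ s.2 i) (f s.1 (σ s.2))) :: s.2)) t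
  have hst : ∀ t, st (t + 1) = (f (st t).1 (σ (st t).2),
    (fun i => G.dist (σ (st t).2 i) (f (st t).1 (σ (st t).2))) :: (st t).2) := fun _ => rfl
  let ρ : ℕ → V := fun t => (st (t + 1)).1
  have hρ : ∀ t, ρ t = f (st t).1 (σ (st t).2) := fun _ => rfl
  have hans : ∀ t, answers G σ ρ t = (st t).2 := by
    intro t
    induction t with
    | zero => rfl
    | succ t ih => rw [answers, ih, hst, hρ]
  have hwalk : IsRobberWalk G ρ := fun t => Or.inr (by rw [hρ (t + 1)]; exact hf _ _)
  obtain ⟨t, ht⟩ := hσ ρ hwalk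
  let b := g (st t).1 (σ (st t).2)
  -- The rival course deviates to the twin in round `t` only, then stays there.
  let ρ' : ℕ → V := fun s => if s < t then ρ s else b
  have hlt : ∀ s < t, ρ' s = ρ s := fun s hs => if_pos hs
  have hge : ∀ s, t ≤ s → ρ' s = b := fun s hs => if_neg (by omega)
  have hwalk' : IsRobberWalk G ρ' := by
    intro s
    rcases lt_trichotomy (s + 1) t with h1 | h1 | h1
    · rw [hlt _ h1, hlt s (by omega)]
      exact hwalk s
    · subst h1
      rw [hge _ le_rfl, hlt s (by omega)]
      exact Or.inr (hg _ _)
    · rw [hge _ h1.le, hge s (by omega)]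
      exact Or.inl rfl
  have hbt : ρ' t = b := hge t le_rfl
  refine hne (st t).1 (σ (st t).2) ?_
  have hcap := ht ρ' hwalk' ?_
  · rw [hbt, hρ] at hcap
    exact hcap.symm
  · have h1 := answers_congr (G := G) σ hlt
    simp only [answers, h1, hbt, hans, hρ]
    congr 1
    funext i
    exact (hfg _ _ i).symm

/-- On a finite connected graph the cops win by occupying every vertex. -/
theorem LocalizationGame.copsWin_card [Fintype V] (hG : G.Connected) :
    CopsWin G (Fintype.card V) := by
  refine ⟨fun _ => (Fintype.equivFin V).symm, fun ρ _ => ⟨0, fun ρ' _ h => ?_⟩⟩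
  simp only [answers, List.cons.injEq, and_true] at h
  have h1 := congrFun h (Fintype.equivFin V (ρ 0))
  simp only [Equiv.symm_apply_apply, SimpleGraph.dist_self] at h1
  exact ((hG.dist_eq_zero_iff).1 h1).symm

/-- Occupying every vertex shows that the infimum is over a nonempty set, so it is attained rather
than the default value 0. -/
theorem LocalizationGame.copsWin_localizationNumber [Fintype V] (hG : G.Connected) :
    CopsWin G (localizationNumber G) := by
  have := hG.nonempty
  exact (Nat.sInf_mem (s := {m : ℕ | 0 < m ∧ CopsWin G m})
    ⟨_, Fintype.card_pos, copsWin_card hG⟩).2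

end Game

/-! ### Distances in Kneser graphs. -/

section Kneser

variable {k n : ℕ}

theorem kneserGraph_adj_iff (hk : 1 ≤ k) (s t : {s : Finset (Fin n) // s.card = k}) :
    (kneserGraph k n).Adj s t ↔ Disjoint s.1 t.1 := by
  refine ⟨fun h => h.2, fun h => ⟨?_, h⟩⟩
  rintro rfl
  have := s.2
  rw [disjoint_self.1 h] at this
  simp at this
  omega

/-- Two `k`-sets cover at most `2k` points, leaving room for a third. -/
theorem kneserGraph_exists_common_neighbor (hk : 1 ≤ k) (hn : 3 * k ≤ n)
    (s t : {s : Finset (Fin n) // s.card = k}) :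
    ∃ w, (kneserGraph k n).Adj s w ∧ (kneserGraph k n).Adj w t := by
  have h1 := Finset.card_union_le s.1 t.1
  have h2 := Finset.card_compl (s.1 ∪ t.1)
  rw [s.2, t.2] at h1
  rw [Fintype.card_fin] at h2
  obtain ⟨w, hw, hwk⟩ := Finset.exists_subset_card_eq (s := (s.1 ∪ t.1)ᶜ) (n := k) (by omega)
  have h3 : Disjoint w (s.1 ∪ t.1) := Finset.subset_compl_iff_disjoint_right.1 hw
  rw [Finset.disjoint_union_right] at h3
  exact ⟨⟨w, hwk⟩, (kneserGraph_adj_iff hk _ _).2 h3.1.symm, (kneserGraph_adj_iff hk _ _).2 h3.2⟩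

theorem kneserGraph_connected (hk : 1 ≤ k) (hn : 3 * k ≤ n) : (kneserGraph k n).Connected := by
  obtain ⟨s, _, hs⟩ := Finset.exists_subset_card_eq (s := (Finset.univ : Finset (Fin n))) (n := k)
    (by rw [Finset.card_univ, Fintype.card_fin]; omega)
  have : Nonempty {s : Finset (Fin n) // s.card = k} := ⟨⟨s, hs⟩⟩
  refine ⟨fun s t => ?_⟩
  obtain ⟨w, h1, h2⟩ := kneserGraph_exists_common_neighbor hk hn s t
  exact h1.reachable.trans h2.reachable

open Classical in
theorem kneserGraph_dist_of_ne (hk : 1 ≤ k) (hn : 3 * k ≤ n)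
    {s t : {s : Finset (Fin n) // s.card = k}} (hst : s ≠ t) :
    (kneserGraph k n).dist s t = if Disjoint s.1 t.1 then 1 else 2 := by
  split_ifs with h
  · exact SimpleGraph.dist_eq_one_iff_adj.2 ((kneserGraph_adj_iff hk _ _).2 h)
  · obtain ⟨w, h1, h2⟩ := kneserGraph_exists_common_neighbor hk hn s t
    have hle : (kneserGraph k n).dist s t ≤ 2 :=
      SimpleGraph.dist_le (.cons h1 (.cons h2 .nil))
    have h0 : (kneserGraph k n).dist s t ≠ 0 := fun h0 =>
      hst (((kneserGraph_connected hk hn).dist_eq_zero_iff).1 h0)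
    have h1 : (kneserGraph k n).dist s t ≠ 1 := fun h1 =>
      h ((kneserGraph_adj_iff hk _ _).1 (SimpleGraph.dist_eq_one_iff_adj.1 h1))
    omega

end Kneser

/-! ### Transversals avoiding the given sets. -/

section Transversal

/-- At most `r` nonempty subsets of a set with at least `2 * r` elements have a transversal with
exactly `r` elements which is none of these subsets. -/
theorem Finset.exists_transversal_ne {ι α : Type*} [DecidableEq α] {r : ℕ} (hr : 2 ≤ r)
    {I : Finset ι} (hI : I.card ≤ r) {Y : Finset α} (hY : 2 * r ≤ Y.card) {f : ι → Finset α}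
    (hf : ∀ i ∈ I, (f i).Nonempty) (hfY : ∀ i ∈ I, f i ⊆ Y) :
    ∃ D ⊆ Y, D.card = r ∧ (∀ i ∈ I, ¬ Disjoint (f i) D) ∧ ∀ i ∈ I, D ≠ f i := by
  classical
  by_cases hT : ∃ T ⊆ Y, T.card ≤ r - 1 ∧ ∀ i ∈ I, ¬ Disjoint (f i) T
  · obtain ⟨T, hTY, hTr, hTf⟩ := hT
    -- With a transversal `T'` of size `r - 1`, each further point of `Y` gives a different
    -- transversal of size `r`. There are at least `r + 1` of them, too many for all to be members.
    obtain ⟨T', hTT', hT'Y, hT'⟩ := Finset.exists_subsuperset_card_eq hTY hTr (by omega)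
    by_contra! hcon
    have key : ∀ y ∈ Y \ T', ∃ i ∈ I, insert y T' = f i := by
      intro y hy
      rw [Finset.mem_sdiff] at hy
      refine hcon _ (Finset.insert_subset hy.1 hT'Y) ?_ fun i hi hd => ?_
      · rw [Finset.card_insert_of_notMem hy.2]; omega
      · exact hTf i hi (hd.mono_right (hTT'.trans (Finset.subset_insert _ _)))
    have hYT : (Y \ T').Nonempty := by
      rw [← Finset.card_pos, Finset.card_sdiff_of_subset hT'Y]
      omega
    have : Nonempty ι := let ⟨i, _⟩ := key _ hYT.choose_spec; ⟨i⟩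
    choose! φ hφI hφ using key
    have hle := Finset.card_le_card_of_injOn φ hφI (s := Y \ T') (t := I) ?_
    · rw [Finset.card_sdiff_of_subset hT'Y] at hle
      omega
    · intro y hy z hz hyz
      have h1 : insert y T' = insert z T' := by rw [hφ y hy, hφ z hz, hyz]
      have h2 : y ∈ insert z T' := h1 ▸ Finset.mem_insert_self y T'
      exact (Finset.mem_insert.1 h2).resolve_right (Finset.mem_sdiff.1 hy).2
  · push Not at hT
    have hYne : Y.Nonempty := Finset.card_pos.1 (by omega)
    have : Nonempty α := ⟨hYne.choose⟩
    choose! t ht using hf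
    have hsub : I.image t ⊆ Y := Finset.image_subset_iff.2 fun i hi => hfY i hi (ht i hi)
    have hhit : ∀ i ∈ I, ¬ Disjoint (f i) (I.image t) := fun i hi =>
      Finset.not_disjoint_iff.2 ⟨t i, ht i hi, Finset.mem_image_of_mem t hi⟩
    have hlarge : ∀ T ⊆ Y, (∀ i ∈ I, ¬ Disjoint (f i) T) → r ≤ T.card := by
      intro T hTY hTf
      by_contra hlt
      obtain ⟨i, hi, hd⟩ := hT T hTY (by omega)
      exact hTf i hi hd
    have hcard := hlarge _ hsub hhit
    have hle : (I.image t).card ≤ I.card := Finset.card_image_le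
    have hinj : Set.InjOn t I := Finset.card_image_iff.1 (by omega)
    refine ⟨I.image t, hsub, by omega, hhit, fun i hi heq => ?_⟩
    -- Now no transversal has fewer than `r` points. If the representatives formed `f i`, then `t i`
    -- could be dropped, since `t j` meets `f i` as well.
    obtain ⟨j, hj, hji⟩ := Finset.exists_mem_ne (s := I) (by omega) i
    have hmem : t i ∈ I.image t := Finset.mem_image_of_mem t hi
    have h1 := hlarge ((I.image t).erase (t i)) ((Finset.erase_subset _ _).trans hsub) ?_
    · rw [Finset.card_erase_of_mem hmem] at h1
      omega
    · intro l hl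
      rw [Finset.not_disjoint_iff]
      by_cases hli : l = i
      · subst hli
        refine ⟨t j, heq ▸ Finset.mem_image_of_mem t hj, Finset.mem_erase.2
          ⟨fun h => hji (hinj hj hl h), Finset.mem_image_of_mem t hj⟩⟩
      · exact ⟨t l, ht l hl, Finset.mem_erase.2
          ⟨fun h => hli (hinj hl hi h), Finset.mem_image_of_mem t hl⟩⟩

end Transversal

/-! ### A discharging bound for separating families. -/

section Discharging

variable {ι α : Type*} [DecidableEq α]

/-- The number of members of the family `e` on `J` that contain `x`. -/
def familyDegree (J : Finset ι) (e : ι → Finset α) (x : α) : ℕ := (J.filter fun i => x ∈ e i).card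

/-- The number of members of the family `e` on `J` that contain both `x` and `y`. -/
def familyCodegree (J : Finset ι) (e : ι → Finset α) (x y : α) : ℕ :=
  (J.filter fun i => x ∈ e i ∧ y ∈ e i).card

variable {J : Finset ι} {e : ι → Finset α} {X P : Finset α} {k : ℕ}

theorem sum_sum_mem_eq_sum_familyDegree_mul (he : ∀ i ∈ J, e i ⊆ X) (g : α → ℝ) :
    ∑ i ∈ J, ∑ x ∈ e i, g x = ∑ x ∈ X, (familyDegree J e x : ℝ) * g x := by
  have h1 : ∀ i ∈ J, ∑ x ∈ e i, g x = ∑ x ∈ X, if x ∈ e i then g x else 0 := fun i hi => by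
    rw [← Finset.sum_filter, Finset.filter_mem_eq_inter, Finset.inter_eq_right.2 (he i hi)]
  rw [Finset.sum_congr rfl h1, Finset.sum_comm]
  refine Finset.sum_congr rfl fun x _ => ?_
  rw [← Finset.sum_filter, Finset.sum_const, nsmul_eq_mul, familyDegree]

theorem sum_familyDegree_le (he : ∀ i ∈ J, e i ⊆ X) (hek : ∀ i ∈ J, (e i).card ≤ k) :
    ∑ x ∈ X, (familyDegree J e x : ℝ) ≤ k * J.card := by
  have h := sum_sum_mem_eq_sum_familyDegree_mul he fun _ => 1
  simp only [mul_one, Finset.sum_const, nsmul_eq_mul] at h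
  rw [← h, mul_comm, ← nsmul_eq_mul]
  exact Finset.sum_le_card_nsmul _ _ _ fun i hi => by exact_mod_cast hek i hi

/-- A bound for the degrees, counting each point of `P` with the additional weight `k`, bounds the
size of the family. -/
theorem card_mul_le_of_sum_familyDegree (hP : P ⊆ X) (he : ∀ i ∈ J, e i ⊆ X)
    (hek : ∀ i ∈ J, (e i).card ≤ k) {c : ℝ}
    (h : 0 ≤ ∑ x ∈ X, ((familyDegree J e x : ℝ) + (if x ∈ P then (k : ℝ) else 0) - c)) :
    c * X.card ≤ k * (J.card + P.card) := by
  have h1 := sum_familyDegree_le he hek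
  rw [Finset.sum_sub_distrib, Finset.sum_add_distrib, ← Finset.sum_filter,
    Finset.filter_mem_eq_inter, Finset.inter_eq_right.2 hP] at h
  simp only [Finset.sum_const, nsmul_eq_mul] at h
  linarith

/-- The share of a point in the members of the family that contain it. -/
noncomputable def pointCharge (J : Finset ι) (e : ι → Finset α) (P : Finset α) (c : ℝ) (x : α) :
    ℝ := if x ∈ P then 1 else 1 - c / familyDegree J e x

theorem pointCharge_of_mem {c : ℝ} {x : α} (hx : x ∈ P) : pointCharge J e P c x = 1 := if_pos hx

theorem pointCharge_of_notMem {c : ℝ} {x : α} (hx : x ∉ P) :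
    pointCharge J e P c x = 1 - c / familyDegree J e x := if_neg hx

/-- If a point lies outside `P` only with degree at least `b`, its charge is at least `1 - c / b`. -/
theorem le_pointCharge {c b : ℝ} (hc : 0 ≤ c) (hb : 0 < b) {x : α}
    (h : x ∉ P → b ≤ familyDegree J e x) : 1 - c / b ≤ pointCharge J e P c x := by
  by_cases hx : x ∈ P
  · rw [pointCharge_of_mem hx]
    have := div_nonneg hc hb.le
    linarith
  · rw [pointCharge_of_notMem hx]
    have := div_le_div_of_nonneg_left hc hb (h hx)
    linarith

/-- The charge of a member of the family, an absent point counting `1`. -/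
noncomputable def memberCharge (J : Finset ι) (e : ι → Finset α) (P : Finset α) (k : ℕ) (c : ℝ)
    (i : ι) : ℝ := k - (e i).card + ∑ x ∈ e i, pointCharge J e P c x

theorem le_memberCharge {c b : ℝ} {i : ι} (hi : (e i).card ≤ k) {S : Finset α} (hS : S ⊆ e i)
    (hb : b ≤ 1) (h : ∀ x ∈ e i, x ∉ S → b ≤ pointCharge J e P c x) :
    ∑ x ∈ S, pointCharge J e P c x + (k - S.card) * b ≤ memberCharge J e P k c i := by
  have h1 : ((e i \ S).card : ℝ) * b ≤ ∑ x ∈ e i \ S, pointCharge J e P c x := by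
    rw [← nsmul_eq_mul]
    exact Finset.card_nsmul_le_sum _ _ _ fun x hx =>
      h x (Finset.mem_sdiff.1 hx).1 (Finset.mem_sdiff.1 hx).2
  have h2 := Finset.sum_sdiff hS (f := pointCharge J e P c)
  have h3 : ((e i \ S).card : ℝ) = (e i).card - S.card := by
    rw [Finset.card_sdiff_of_subset hS, Nat.cast_sub (Finset.card_le_card hS)]
  have h4 : ((e i).card : ℝ) ≤ k := by exact_mod_cast hi
  rw [h3] at h1
  rw [memberCharge]
  nlinarith [mul_nonneg (sub_nonneg.2 h4) (sub_nonneg.2 hb)]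

/-- Double counting: outside `P`, a point of degree `d` contributes `d * (1 - c / d) = d - c` in
all. Nonnegative total charge therefore yields the desired bound. -/
theorem card_mul_add_sum_memberCharge_le {c : ℝ} (hck : c ≤ k) (hP : P ⊆ X)
    (he : ∀ i ∈ J, e i ⊆ X) (hpos : ∀ x ∈ X, x ∉ P → 0 < familyDegree J e x) :
    c * X.card + ∑ i ∈ J, memberCharge J e P k c i ≤ k * (J.card + P.card) := by
  have h1 : ∑ x ∈ X, (familyDegree J e x : ℝ) * pointCharge J e P c x
      = ∑ x ∈ X, ((familyDegree J e x : ℝ) - c + if x ∈ P then c else 0) := by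
    refine Finset.sum_congr rfl fun x hx => ?_
    by_cases hxP : x ∈ P
    · rw [pointCharge_of_mem hxP, if_pos hxP]; ring
    · have : (familyDegree J e x : ℝ) ≠ 0 := by exact_mod_cast (hpos x hx hxP).ne'
      rw [pointCharge_of_notMem hxP, if_neg hxP]
      field_simp
      ring
  have h2 := sum_sum_mem_eq_sum_familyDegree_mul he fun _ => 1
  have h3 := sum_sum_mem_eq_sum_familyDegree_mul he (pointCharge J e P c)
  rw [h1, Finset.sum_add_distrib, ← Finset.sum_filter, Finset.filter_mem_eq_inter,
    Finset.inter_eq_right.2 hP, Finset.sum_sub_distrib] at h3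
  simp only [memberCharge, Finset.sum_add_distrib, Finset.sum_sub_distrib, Finset.sum_const,
    nsmul_eq_mul, mul_one] at h2 h3 ⊢
  have h4 : (P.card : ℝ) * c ≤ P.card * k := by gcongr
  linarith

theorem one_le_familyCodegree {i : ι} (hi : i ∈ J) {x y : α} (hx : x ∈ e i) (hy : y ∈ e i) :
    1 ≤ familyCodegree J e x y :=
  Finset.card_pos.2 ⟨i, Finset.mem_filter.2 ⟨hi, hx, hy⟩⟩

theorem one_le_familyDegree {i : ι} (hi : i ∈ J) {x : α} (hx : x ∈ e i) :
    1 ≤ familyDegree J e x :=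
  Finset.card_pos.2 ⟨i, Finset.mem_filter.2 ⟨hi, hx⟩⟩

/-- Members of the family have nonnegative charge, apart from those with a point of degree one. -/
theorem memberCharge_nonneg (hk : 3 ≤ k) (he : ∀ i ∈ J, e i ⊆ X)
    (hek : ∀ i ∈ J, (e i).card ≤ k)
    (hsep : ∀ x ∈ X, x ∉ P → ∀ y ∈ X, y ∉ P → x ≠ y →
      k + 2 * familyCodegree J e x y ≤ familyDegree J e x + familyDegree J e y)
    {i : ι} (hi : i ∈ J) (h2 : ∀ x ∈ e i, x ∉ P → 2 ≤ familyDegree J e x) :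
    0 ≤ memberCharge J e P k ((k + 2 : ℝ) / 2) i := by
  have hk' : (3 : ℝ) ≤ k := by exact_mod_cast hk
  by_cases hlow : ∃ x ∈ e i, x ∉ P ∧ 2 * familyDegree J e x < k + 2
  · obtain ⟨x, hx, hxP, hxlow⟩ := hlow
    have hd2 : (2 : ℝ) ≤ familyDegree J e x := by exact_mod_cast h2 x hx hxP
    have hlow' : 2 * (familyDegree J e x : ℝ) < k + 2 := by exact_mod_cast hxlow
    have hb : (0 : ℝ) < k + 2 - familyDegree J e x := by linarith
    have key := le_memberCharge (J := J) (P := P) (c := (k + 2 : ℝ) / 2)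
      (b := 1 - (k + 2 : ℝ) / 2 / (k + 2 - familyDegree J e x)) (hek i hi)
      (Finset.singleton_subset_iff.2 hx)
      (by have : 0 ≤ (k + 2 : ℝ) / 2 / (k + 2 - familyDegree J e x) := by positivity
          linarith)
      (fun y hy hyx => le_pointCharge (by positivity) hb fun hyP => by
        have h3 := hsep x (he i hi hx) hxP y (he i hi hy) hyP
          (fun h => hyx (Finset.mem_singleton.2 h.symm))
        have h4 := one_le_familyCodegree hi hx hy
        have h5 : k + 2 ≤ familyDegree J e x + familyDegree J e y := by omega
        have h6 : (k : ℝ) + 2 ≤ familyDegree J e x + familyDegree J e y := by exact_mod_cast h5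
        linarith)
    rw [Finset.sum_singleton, Finset.card_singleton, pointCharge_of_notMem hxP] at key
    refine le_trans ?_ key
    generalize (familyDegree J e x : ℝ) = d at *
    generalize (k : ℝ) = κ at *
    have hd : 0 < d := by linarith
    -- The first factor is nonnegative because `d` is low. The second needs `d ≥ 2`, which is why
    -- degrees 0 and 1 are treated separately.
    have : 1 - (κ + 2) / 2 / d + (κ - (1 : ℕ)) * (1 - (κ + 2) / 2 / (κ + 2 - d))
        = (κ + 2 - 2 * d) * (κ * d - (κ + 2)) / (2 * d * (κ + 2 - d)) := by
      field_simp
      push_cast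
      ring
    rw [this]
    have h7 : 0 ≤ κ * d - (κ + 2) := by nlinarith
    have h8 : 0 ≤ κ + 2 - 2 * d := by linarith
    positivity
  · push Not at hlow
    have key := le_memberCharge (J := J) (P := P) (c := (k + 2 : ℝ) / 2) (b := 0) (hek i hi)
      (Finset.empty_subset _) zero_le_one (fun y hy _ => by
        have := le_pointCharge (J := J) (e := e) (P := P) (c := (k + 2 : ℝ) / 2)
          (b := (k + 2 : ℝ) / 2) (x := y) (by positivity) (by positivity) fun hyP => by
            have h3 : ((k + 2 : ℕ) : ℝ) ≤ (2 * familyDegree J e y : ℕ) := by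
              exact_mod_cast hlow y hy hyP
            push_cast at h3
            linarith
        rwa [div_self (by positivity), sub_self] at this)
    simpa using key

/-- The case with an uncovered point. -/
theorem card_mul_le_of_familyDegree_eq_zero (hk : 3 ≤ k) (hX : 2 * k ≤ X.card) (hP : P ⊆ X)
    (he : ∀ i ∈ J, e i ⊆ X) (hek : ∀ i ∈ J, (e i).card ≤ k)
    (hsep : ∀ x ∈ X, x ∉ P → ∀ y ∈ X, y ∉ P → x ≠ y →
      k + 2 * familyCodegree J e x y ≤ familyDegree J e x + familyDegree J e y)
    {x₀ : α} (hx₀ : x₀ ∈ X) (hx₀P : x₀ ∉ P) (h0 : familyDegree J e x₀ = 0) :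
    (k + 2 : ℝ) / 2 * X.card ≤ k * (J.card + P.card) := by
  have hk' : (3 : ℝ) ≤ k := by exact_mod_cast hk
  refine card_mul_le_of_sum_familyDegree hP he hek ?_
  rw [← Finset.add_sum_erase X _ hx₀, if_neg hx₀P, h0]
  have h1 : ((X.erase x₀).card : ℝ) * ((k - 2 : ℝ) / 2) ≤ ∑ x ∈ X.erase x₀,
      ((familyDegree J e x : ℝ) + (if x ∈ P then (k : ℝ) else 0) - (k + 2) / 2) := by
    rw [← nsmul_eq_mul]
    refine Finset.card_nsmul_le_sum _ _ _ fun x hx => ?_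
    obtain ⟨hne, hx⟩ := Finset.mem_erase.1 hx
    split_ifs with hxP
    · have : (0 : ℝ) ≤ familyDegree J e x := Nat.cast_nonneg _
      linarith
    · have h2 := hsep x₀ hx₀ hx₀P x hx hxP hne.symm
      have h3 : k ≤ familyDegree J e x := by omega
      have h4 : (k : ℝ) ≤ familyDegree J e x := by exact_mod_cast h3
      linarith
  have h2 : (2 * k - 1 : ℝ) ≤ (X.erase x₀).card := by
    rw [Finset.card_erase_of_mem hx₀, Nat.cast_sub (by omega)]
    have : ((2 * k : ℕ) : ℝ) ≤ X.card := by exact_mod_cast hX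
    push_cast at this ⊢
    linarith
  push_cast
  -- The surplus `(2k - 1)(k - 2) / 2` covers the deficit `(k + 2) / 2` of `x₀` exactly when `k ≥
  -- 3`.
  nlinarith

/-- The case with a point of degree one, for members of size at least four. -/
theorem card_mul_le_of_familyDegree_eq_one (hk : 4 ≤ k) (hP : P ⊆ X)
    (he : ∀ i ∈ J, e i ⊆ X) (hek : ∀ i ∈ J, (e i).card ≤ k)
    (hsep : ∀ x ∈ X, x ∉ P → ∀ y ∈ X, y ∉ P → x ≠ y →
      k + 2 * familyCodegree J e x y ≤ familyDegree J e x + familyDegree J e y)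
    {x₀ y : α} (hx₀ : x₀ ∈ X) (hx₀P : x₀ ∉ P) (h1 : familyDegree J e x₀ = 1)
    {i : ι} (hi : i ∈ J) (hx₀i : x₀ ∈ e i) (hyi : y ∈ e i) (hyx : y ≠ x₀) :
    (k + 2 : ℝ) / 2 * X.card ≤ k * (J.card + P.card) := by
  have hk' : (4 : ℝ) ≤ k := by exact_mod_cast hk
  have hy : y ∈ X.erase x₀ := Finset.mem_erase.2 ⟨hyx, he i hi hyi⟩
  refine card_mul_le_of_sum_familyDegree hP he hek ?_
  rw [← Finset.add_sum_erase X _ hx₀, if_neg hx₀P, h1, ← Finset.add_sum_erase _ _ hy]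
  have h2 : 0 ≤ ∑ x ∈ (X.erase x₀).erase y,
      ((familyDegree J e x : ℝ) + (if x ∈ P then (k : ℝ) else 0) - (k + 2) / 2) := by
    refine Finset.sum_nonneg fun x hx => ?_
    obtain ⟨hne, hx⟩ := Finset.mem_erase.1 (Finset.mem_of_mem_erase hx)
    split_ifs with hxP
    · have : (0 : ℝ) ≤ familyDegree J e x := Nat.cast_nonneg _
      linarith
    · have h2 := hsep x₀ hx₀ hx₀P x hx hxP hne.symm
      have h3 : k ≤ familyDegree J e x + 1 := by omega
      have h4 : (k : ℝ) ≤ familyDegree J e x + 1 := by exact_mod_cast h3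
      linarith
  -- The point `y` sharing a member with `x₀` compensates it: `1 + (k + 1) = 2c` for `c = (k + 2) /
  -- 2`.
  have h3 : (k : ℝ) + 1 ≤ familyDegree J e y + if y ∈ P then (k : ℝ) else 0 := by
    split_ifs with hyP
    · have : (1 : ℝ) ≤ familyDegree J e y := by exact_mod_cast one_le_familyDegree hi hyi
      linarith
    · have h4 := hsep x₀ hx₀ hx₀P y (he i hi hyi) hyP hyx.symm
      have h5 := one_le_familyCodegree hi hx₀i hyi
      have h6 : k + 1 ≤ familyDegree J e y := by omega
      have h7 : (k : ℝ) + 1 ≤ familyDegree J e y := by exact_mod_cast h6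
      linarith
  push_cast
  linarith

/-- The case with a point of degree one, for members of size at most three. -/
theorem card_mul_le_of_familyDegree_eq_one_of_card_le_three [DecidableEq ι] (hP : P ⊆ X)
    (he : ∀ i ∈ J, e i ⊆ X) (hek : ∀ i ∈ J, (e i).card ≤ 3)
    (hsep : ∀ x ∈ X, x ∉ P → ∀ y ∈ X, y ∉ P → x ≠ y →
      3 + 2 * familyCodegree J e x y ≤ familyDegree J e x + familyDegree J e y)
    {x₀ : α} (hx₀ : x₀ ∈ X) (hx₀P : x₀ ∉ P) (h1 : familyDegree J e x₀ = 1)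
    {i : ι} (hi : i ∈ J) (hx₀i : x₀ ∈ e i) :
    ((3 : ℕ) + 2 : ℝ) / 2 * X.card ≤ (3 : ℕ) * (J.card + P.card) := by
  set c : ℝ := ((3 : ℕ) + 2 : ℝ) / 2 with hc
  have hc' : c = 5 / 2 := by rw [hc]; norm_num
  have hnn₀ := fun j (hj : j ∈ J) => memberCharge_nonneg (i := j) le_rfl he hek hsep hj
  rw [← hc] at hnn₀
  clear_value c
  have hother : ∀ x ∈ X, x ∉ P → x ≠ x₀ → 2 ≤ familyDegree J e x := fun x hx hxP hne => by
    have := hsep x₀ hx₀ hx₀P x hx hxP hne.symm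
    omega
  have hpos : ∀ x ∈ X, x ∉ P → 0 < familyDegree J e x := fun x hx hxP => by
    by_cases hne : x = x₀
    · subst hne; omega
    · have := hother x hx hxP hne; omega
  have honly : ∀ j ∈ J, j ≠ i → x₀ ∉ e j := by
    intro j hj hji hxj
    have : ({i, j} : Finset ι) ⊆ J.filter fun l => x₀ ∈ e l := by
      intro l hl
      rcases Finset.mem_insert.1 hl with rfl | hl
      · exact Finset.mem_filter.2 ⟨hi, hx₀i⟩
      · rw [Finset.mem_singleton.1 hl]
        exact Finset.mem_filter.2 ⟨hj, hxj⟩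
    have h2 := Finset.card_le_card this
    rw [Finset.card_pair hji.symm] at h2
    rw [familyDegree] at h1
    omega
  have hnn : ∀ j ∈ J, j ≠ i → 0 ≤ memberCharge J e P 3 c j := fun j hj hji =>
    hnn₀ j hj fun x hx hxP =>
      hother x (he j hj hx) hxP fun h => honly j hj hji (h ▸ hx)
  refine le_trans ?_ (card_mul_add_sum_memberCharge_le (c := c) (by rw [hc']; norm_num) hP he hpos)
  rw [le_add_iff_nonneg_right, ← Finset.add_sum_erase J _ hi]
  have hnn' : 0 ≤ ∑ j ∈ J.erase i, memberCharge J e P 3 c j := Finset.sum_nonneg fun j hj =>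
    hnn j (Finset.mem_of_mem_erase hj) (Finset.ne_of_mem_erase hj)
  have hg₀ : pointCharge J e P c x₀ = -(3 / 2) := by
    rw [pointCharge_of_notMem hx₀P, h1, hc']; norm_num
  have hgi : ∀ x ∈ e i, x ≠ x₀ → x ∉ P → 4 ≤ familyDegree J e x := fun x hx hne hxP => by
    have h2 := hsep x₀ hx₀ hx₀P x (he i hi hx) hxP hne.symm
    have h3 := one_le_familyCodegree hi hx₀i hx
    omega
  by_cases hy : ∃ y ∈ e i, y ≠ x₀ ∧ y ∉ P
  · obtain ⟨y, hyi, hyx, hyP⟩ := hy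
    have hy4 := hgi y hyi hyx hyP
    have hgy : 3 / 8 ≤ pointCharge J e P c y := by
      have := le_pointCharge (J := J) (e := e) (P := P) (c := c) (b := 4) (x := y)
        (by rw [hc']; norm_num) (by norm_num) fun _ => by exact_mod_cast hy4
      rw [hc'] at this ⊢
      linarith
    have hedge : -(3 / 4) ≤ memberCharge J e P 3 c i := by
      have := le_memberCharge (J := J) (P := P) (c := c) (b := 3 / 8) (hek i hi)
        (Finset.singleton_subset_iff.2 hx₀i) (by norm_num) (fun x hx hne => by
          have := le_pointCharge (J := J) (e := e) (P := P) (c := c) (b := 4) (x := x)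
            (by rw [hc']; norm_num) (by norm_num) fun hxP => by
              exact_mod_cast hgi x hx (fun h => hne (Finset.mem_singleton.2 h)) hxP
          rw [hc'] at this ⊢
          linarith)
      rw [Finset.sum_singleton, hg₀, Finset.card_singleton] at this
      push_cast at this
      linarith
    -- The member `i` may lack `3/4`. The point `y` lies in at least three other members, each with
    -- charge at least `1/4`, which make up for it.
    set K := (J.filter fun j => y ∈ e j).erase i with hK
    have hKcard : 3 ≤ K.card := by
      rw [hK, Finset.card_erase_of_mem (Finset.mem_filter.2 ⟨hi, hyi⟩)]
      rw [familyDegree] at hy4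
      omega
    have hKJ : K ⊆ J.erase i := Finset.erase_subset_erase _ (Finset.filter_subset _ _)
    have hKc : ∀ j ∈ K, 1 / 4 ≤ memberCharge J e P 3 c j := by
      intro j hjK
      obtain ⟨hji, hj⟩ := Finset.mem_erase.1 hjK
      obtain ⟨hj, hyj⟩ := Finset.mem_filter.1 hj
      by_cases hlow : ∃ z ∈ e j, z ∉ P ∧ familyDegree J e z < 3
      · obtain ⟨z, hzj, hzP, hz3⟩ := hlow
        have hz2 := hother z (he j hj hzj) hzP fun h => honly j hj hji (h ▸ hzj)
        have hz : familyDegree J e z = 2 := by omega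
        have hyz : y ≠ z := by rintro rfl; omega
        have := le_memberCharge (J := J) (P := P) (c := c) (b := 1 / 6) (hek j hj)
          (S := {y, z}) (Finset.insert_subset hyj (Finset.singleton_subset_iff.2 hzj))
          (by norm_num) (fun x hx hne => by
            have := le_pointCharge (J := J) (e := e) (P := P) (c := c) (b := 3) (x := x)
              (by rw [hc']; norm_num) (by norm_num) fun hxP => by
                have h2 := hsep z (he j hj hzj) hzP x (he j hj hx) hxP fun h =>
                  hne (by rw [← h]; simp)
                have h3 := one_le_familyCodegree hj hzj hx
                have h4 : 3 ≤ familyDegree J e x := by omega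
                exact_mod_cast h4
            rw [hc'] at this ⊢
            linarith)
        have hgz : pointCharge J e P c z = -(1 / 4) := by
          rw [pointCharge_of_notMem hzP, hz, hc']; norm_num
        rw [Finset.sum_pair hyz, hgz, Finset.card_pair hyz] at this
        push_cast at this
        linarith
      · push Not at hlow
        have := le_memberCharge (J := J) (P := P) (c := c) (b := 0) (hek j hj)
          (Finset.singleton_subset_iff.2 hyj) (by norm_num) (fun x hx _ => by
            have := le_pointCharge (J := J) (e := e) (P := P) (c := c) (b := 3) (x := x)
              (by rw [hc']; norm_num) (by norm_num) fun hxP => by exact_mod_cast hlow x hx hxP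
            rw [hc'] at this ⊢
            linarith)
        rw [Finset.sum_singleton] at this
        linarith
    have hsum : (3 : ℝ) / 4 ≤ ∑ j ∈ K, memberCharge J e P 3 c j := by
      have h2 := Finset.card_nsmul_le_sum K (memberCharge J e P 3 c) (1 / 4) hKc
      rw [nsmul_eq_mul] at h2
      have h3 : (3 : ℝ) ≤ K.card := by exact_mod_cast hKcard
      linarith
    have := Finset.sum_le_sum_of_subset_of_nonneg hKJ (f := memberCharge J e P 3 c)
      fun j hj _ => hnn j (Finset.mem_of_mem_erase hj) (Finset.ne_of_mem_erase hj)
    linarith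
  · push Not at hy
    have := le_memberCharge (J := J) (P := P) (c := c) (b := 1) (hek i hi)
      (Finset.singleton_subset_iff.2 hx₀i) le_rfl (fun x hx hne => by
        rw [pointCharge_of_mem (hy x hx fun h => hne (Finset.mem_singleton.2 h))])
    rw [Finset.sum_singleton, hg₀, Finset.card_singleton] at this
    push_cast at this
    linarith

/-- A family of sets of size at most `k` on `X`, any two points outside `P` being separated by at
least `k` members, has, together with `P`, at least `(k + 2) / (2 * k) * |X|` elements. -/
theorem card_mul_le_of_separating (hk : 3 ≤ k) (hX : 2 * k ≤ X.card) (hP : P ⊆ X)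
    (he : ∀ i ∈ J, e i ⊆ X) (hek : ∀ i ∈ J, (e i).card ≤ k) (hne : ∀ i ∈ J, (e i).card ≠ 1)
    (hsep : ∀ x ∈ X, x ∉ P → ∀ y ∈ X, y ∉ P → x ≠ y →
      k + 2 * familyCodegree J e x y ≤ familyDegree J e x + familyDegree J e y) :
    (k + 2 : ℝ) / 2 * X.card ≤ k * (J.card + P.card) := by
  classical
  have hk' : (3 : ℝ) ≤ k := by exact_mod_cast hk
  by_cases h2 : ∀ x ∈ X, x ∉ P → 2 ≤ familyDegree J e x
  · refine le_trans ?_ (card_mul_add_sum_memberCharge_le (c := (k + 2 : ℝ) / 2) (by linarith) hP he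
      fun x hx hxP => by have := h2 x hx hxP; omega)
    rw [le_add_iff_nonneg_right]
    exact Finset.sum_nonneg fun i hi => memberCharge_nonneg hk he hek hsep hi fun x hx hxP =>
      h2 x (he i hi hx) hxP
  · push Not at h2
    obtain ⟨x₀, hx₀, hx₀P, hd⟩ := h2
    obtain h0 | h1 : familyDegree J e x₀ = 0 ∨ familyDegree J e x₀ = 1 := by omega
    · exact card_mul_le_of_familyDegree_eq_zero hk hX hP he hek hsep hx₀ hx₀P h0
    · obtain ⟨i, hi⟩ := Finset.card_pos.1 (show 0 < familyDegree J e x₀ by omega)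
      obtain ⟨hi, hx₀i⟩ := Finset.mem_filter.1 hi
      rcases hk.eq_or_lt with rfl | hk4
      · exact card_mul_le_of_familyDegree_eq_one_of_card_le_three hP he hek hsep hx₀ hx₀P h1 hi hx₀i
      · have h3 := hne i hi
        have h4 : 0 < (e i).card := Finset.card_pos.2 ⟨x₀, hx₀i⟩
        obtain ⟨y, hyi, hyx⟩ := Finset.exists_mem_ne (s := e i) (by omega) x₀
        exact card_mul_le_of_familyDegree_eq_one hk4 hP he hek hsep hx₀ hx₀P h1 hi hx₀i hyi hyx

end Discharging

/-! ### From an indistinguishable pair to the bound on the cops. -/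

section KneserGame

variable {k n m : ℕ}

theorem familyDegree_add_familyDegree {ι α : Type*} [DecidableEq α] (J : Finset ι)
    (e : ι → Finset α) (x y : α) :
    familyDegree J e x + familyDegree J e y =
      (J.filter fun i => ¬ (x ∈ e i ↔ y ∈ e i)).card + 2 * familyCodegree J e x y := by
  simp only [familyDegree, familyCodegree, Finset.card_filter, Finset.mul_sum,
    ← Finset.sum_add_distrib]
  refine Finset.sum_congr rfl fun i _ => ?_
  by_cases hx : x ∈ e i <;> by_cases hy : y ∈ e i <;> simp [hx, hy]

/-- If fewer than `k` cops, seen outside `A`, separate the points `x` and `y` outside `A`, neither of them being the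
only point of a cop outside `A`, then the probe does not tell apart some pair of neighbours
of `A`. -/
theorem kneserGraph_exists_indistinguishable (hk : 3 ≤ k) (hn : 3 * k ≤ n)
    (A : {s : Finset (Fin n) // s.card = k}) (u : Fin m → {s : Finset (Fin n) // s.card = k})
    {x y : Fin n} (hxA : x ∉ A.1) (hyA : y ∉ A.1) (hxy : x ≠ y)
    (hx : ∀ i, (u i).1 \ A.1 ≠ {x}) (hy : ∀ i, (u i).1 \ A.1 ≠ {y})
    (hlt : (Finset.univ.filter fun i => ¬ (x ∈ (u i).1 \ A.1 ↔ y ∈ (u i).1 \ A.1)).card < k) :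
    ∃ a b, a ≠ b ∧ (kneserGraph k n).Adj A a ∧ (kneserGraph k n).Adj A b ∧
      ∀ i, (kneserGraph k n).dist (u i) a = (kneserGraph k n).dist (u i) b := by
  set I := Finset.univ.filter fun i => ¬ (x ∈ (u i).1 \ A.1 ↔ y ∈ (u i).1 \ A.1) with hI
  have hYcard : 2 * (k - 1) ≤ ((A.1ᶜ.erase x).erase y).card := by
    rw [Finset.card_erase_of_mem (by simp [hyA, hxy.symm]),
      Finset.card_erase_of_mem (by simp [hxA]), Finset.card_compl, A.2, Fintype.card_fin]
    omega
  obtain ⟨D, hDY, hDcard, hDhit, hDne⟩ := Finset.exists_transversal_ne (r := k - 1) (by omega)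
    (I := I) (by omega) hYcard (f := fun i => (((u i).1 \ A.1).erase x).erase y)
    (fun i hi => by
      have hi' := (Finset.mem_filter.1 hi).2
      by_contra hempty
      rw [Finset.not_nonempty_iff_eq_empty] at hempty
      have hsub : ∀ z ∈ (u i).1 \ A.1, z = y ∨ z = x := fun z hz => by
        by_contra! hz'
        have : z ∈ (((u i).1 \ A.1).erase x).erase y :=
          Finset.mem_erase.2 ⟨hz'.1, Finset.mem_erase.2 ⟨hz'.2, hz⟩⟩
        rw [hempty] at this
        exact Finset.notMem_empty _ this
      by_cases hxi : x ∈ (u i).1 \ A.1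
      · refine hx i (Finset.eq_singleton_iff_unique_mem.2 ⟨hxi, fun z hz => ?_⟩)
        refine (hsub z hz).resolve_left ?_
        rintro rfl
        exact hi' (iff_of_true hxi hz)
      · have hyi : y ∈ (u i).1 \ A.1 := by
          by_contra hyi
          exact hi' (iff_of_false hxi hyi)
        refine hy i (Finset.eq_singleton_iff_unique_mem.2 ⟨hyi, fun z hz => ?_⟩)
        refine (hsub z hz).resolve_right ?_
        rintro rfl
        exact hxi hz)
    (fun i _ => Finset.erase_subset_erase _ (Finset.erase_subset_erase _ fun z hz =>
      Finset.mem_compl.2 (Finset.mem_sdiff.1 hz).2))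
  have hDA : ∀ z ∈ D, z ∉ A.1 := fun z hz => by
    have := hDY hz
    simp only [Finset.mem_erase, Finset.mem_compl] at this
    exact this.2.2
  have hyD : y ∉ D := fun h => by simpa using hDY h
  have hxD : x ∉ D := fun h => by simpa using hDY h
  have hadj : ∀ z (hz : (insert z D).card = k), z ∉ A.1 →
      (kneserGraph k n).Adj A ⟨insert z D, hz⟩ := fun z hz hzA => by
    rw [kneserGraph_adj_iff (by omega), Finset.disjoint_insert_right]
    exact ⟨hzA, Finset.disjoint_right.2 hDA⟩
  have hxc : (insert x D).card = k := by rw [Finset.card_insert_of_notMem hxD]; omega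
  have hyc : (insert y D).card = k := by rw [Finset.card_insert_of_notMem hyD]; omega
  -- A cop on `D ∪ {z}` would separate `x` from `y` and meet the complement of `A` in `D` only.
  have hnot : ∀ z w i, ({z, w} : Finset (Fin n)) = {x, y} → z ≠ w → z ∉ A.1 → z ∉ D → w ∉ D →
      (u i).1 ≠ insert z D := by
    intro z w i hzw hne hzA hzD hwD heq
    have hsd : (u i).1 \ A.1 = insert z D := by
      rw [heq, Finset.sdiff_eq_self_iff_disjoint, Finset.disjoint_insert_left]
      exact ⟨hzA, Finset.disjoint_left.2 hDA⟩
    have h1 : x = z ∨ x = w := by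
      have : x ∈ ({z, w} : Finset (Fin n)) := by rw [hzw]; simp
      simpa using this
    have h2 : y = z ∨ y = w := by
      have : y ∈ ({z, w} : Finset (Fin n)) := by rw [hzw]; simp
      simpa using this
    have hiI : i ∈ I := by
      rw [hI, Finset.mem_filter, hsd]
      refine ⟨Finset.mem_univ _, ?_⟩
      simp only [Finset.mem_insert, hxD, hyD, or_false]
      grind
    refine hDne i hiI ?_
    simp only [hsd]
    ext v
    simp only [Finset.mem_erase, Finset.mem_insert]
    grind
  refine ⟨⟨insert x D, hxc⟩, ⟨insert y D, hyc⟩, fun h => ?_, hadj x hxc hxA, hadj y hyc hyA,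
    fun i => ?_⟩
  · have h0 : insert x D = insert y D := congrArg Subtype.val h
    have h1 : x ∈ insert y D := h0 ▸ Finset.mem_insert_self x D
    exact (Finset.mem_insert.1 h1).elim hxy hxD
  · rw [kneserGraph_dist_of_ne (by omega) hn
        (fun h => hnot x y i rfl hxy hxA hxD hyD (congrArg Subtype.val h)),
      kneserGraph_dist_of_ne (by omega) hn
        (fun h => hnot y x i (Finset.pair_comm _ _) hxy.symm hyA hyD hxD (congrArg Subtype.val h))]
    refine if_congr ?_ rfl rfl
    rw [Finset.disjoint_insert_right, Finset.disjoint_insert_right]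
    by_cases hi : i ∈ I
    · have : ¬ Disjoint (u i).1 D := fun h => hDhit i hi (h.mono_left
        ((Finset.erase_subset _ _).trans ((Finset.erase_subset _ _).trans Finset.sdiff_subset)))
      simp [this]
    · have : x ∈ (u i).1 ↔ y ∈ (u i).1 := by
        simpa [hI, hxA, hyA] using hi
      rw [this]

theorem kneserGraph_le_of_copsWin (hk : 3 ≤ k) (hn : 3 * k ≤ n)
    (hm : LocalizationGame.CopsWin (kneserGraph k n) m) :
    (k + 2 : ℝ) / 2 * (n - k) ≤ k * m := by
  have := (kneserGraph_connected (by omega : 1 ≤ k) hn).nonempty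
  by_contra hcon
  refine LocalizationGame.not_copsWin (fun A u => ?_) hm
  by_contra hind
  refine hcon ?_
  set e : Fin m → Finset (Fin n) := fun i => (u i).1 \ A.1 with he
  set J := Finset.univ.filter fun i => (e i).card ≠ 1 with hJ
  set P := A.1ᶜ.filter fun x => ∃ i, e i = {x} with hP
  have hXcard : A.1ᶜ.card = n - k := by rw [Finset.card_compl, A.2, Fintype.card_fin]
  have hJP : J.card + P.card ≤ m := by
    have h1 : P.card ≤ (Finset.univ.filter fun i => (e i).card = 1).card := by
      have hex : ∀ x ∈ P, ∃ i, e i = {x} := fun x hx => (Finset.mem_filter.1 hx).2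
      refine Finset.card_le_card_of_surjOn
        -- The default is an arbitrary point of `A`, never used for a singleton trace.
        (fun i => if h : ∃ x, e i = {x} then h.choose else A.1.min' ?_) ?_
      · exact Finset.card_pos.1 (by rw [A.2]; omega)
      · intro x hx
        obtain ⟨i, hi⟩ := hex x hx
        have h : ∃ x, e i = {x} := ⟨x, hi⟩
        refine ⟨i, by simp [hi], ?_⟩
        simp only [dif_pos h]
        exact Finset.singleton_injective (h.choose_spec.symm.trans hi)
    have h2 := Finset.card_filter_add_card_filter_not (s := (Finset.univ : Finset (Fin m)))
      fun i => (e i).card = 1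
    rw [Finset.card_univ, Fintype.card_fin] at h2
    have h3 : J.card = (Finset.univ.filter fun i => ¬ (e i).card = 1).card := rfl
    omega
  have key := card_mul_le_of_separating (J := J) (e := e) (X := A.1ᶜ) (P := P) hk
    (by rw [hXcard]; omega) (Finset.filter_subset _ _)
    (fun i _ z hz => Finset.mem_compl.2 (Finset.mem_sdiff.1 hz).2)
    (fun i _ => (Finset.card_le_card Finset.sdiff_subset).trans (u i).2.le)
    (fun i hi => (Finset.mem_filter.1 hi).2)
    (fun x hx hxP y hy hyP hxy => by
      have hx' : ∀ i, e i ≠ {x} := fun i hi => hxP (Finset.mem_filter.2 ⟨hx, i, hi⟩)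
      have hy' : ∀ i, e i ≠ {y} := fun i hi => hyP (Finset.mem_filter.2 ⟨hy, i, hi⟩)
      rw [familyDegree_add_familyDegree]
      have h1 : k ≤ (Finset.univ.filter fun i => ¬ (x ∈ e i ↔ y ∈ e i)).card := by
        by_contra hlt
        exact hind (kneserGraph_exists_indistinguishable hk hn A u (Finset.mem_compl.1 hx)
          (Finset.mem_compl.1 hy) hxy hx' hy' (not_le.1 hlt))
      -- A singleton trace separates only pairs containing its point, and `x`, `y` are not such
      -- points.
      have h2 : (Finset.univ.filter fun i => ¬ (x ∈ e i ↔ y ∈ e i)) ⊆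
          J.filter fun i => ¬ (x ∈ e i ↔ y ∈ e i) := by
        intro i hi
        have hi' := (Finset.mem_filter.1 hi).2
        refine Finset.mem_filter.2 ⟨Finset.mem_filter.2 ⟨Finset.mem_univ _, fun h => ?_⟩, hi'⟩
        obtain ⟨z, hz⟩ := Finset.card_eq_one.1 h
        refine hi' (iff_of_false (fun h => ?_) fun h => ?_)
        · rw [hz, Finset.mem_singleton] at h
          exact hx' i (h ▸ hz)
        · rw [hz, Finset.mem_singleton] at h
          exact hy' i (h ▸ hz)
      have h3 := Finset.card_le_card h2
      omega)
  rw [hXcard, Nat.cast_sub (by omega)] at key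
  refine key.trans ?_
  have : (J.card + P.card : ℝ) ≤ m := by exact_mod_cast hJP
  gcongr

end KneserGame

theorem lemma2p5 :
    (∀ k n : ℕ, 3 ≤ k → 3 * k ≤ n →
      (n : ℝ) / 2 + (n : ℝ) / (k : ℝ) - (k : ℝ) / 2 - 1
        ≤ (localizationNumber (kneserGraph k n) : ℝ)) ∧
    (∀ n : ℕ, 3 * 4 ≤ n →
      (3 * (n : ℝ) - 13) / 4 ≤ (localizationNumber (kneserGraph 4 n) : ℝ)) := by
  have key : ∀ k n : ℕ, 3 ≤ k → 3 * k ≤ n →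
      (k + 2 : ℝ) / 2 * (n - k) ≤ k * localizationNumber (kneserGraph k n) := fun k n hk hn =>
    kneserGraph_le_of_copsWin hk hn
      (LocalizationGame.copsWin_localizationNumber (kneserGraph_connected (by omega) hn))
  refine ⟨fun k n hk hn => ?_, fun n hn => ?_⟩
  · have hk0 : (0 : ℝ) < k := by exact_mod_cast (by omega : 0 < k)
    refine le_of_mul_le_mul_left ((le_of_eq ?_).trans (key k n hk hn)) hk0
    field_simp
    ring
  · have := key 4 n (by norm_num) hn
    push_cast at this
    linarith
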